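/- Let $N \ge 4$. Let $k_i = \begin{pmatrix} a_i & b_i \\ c_i & d_i \end{pmatrix}$, $1 \le i \le N$, be $2\times 2$ matrices of independent variables, let $\mathbb{C}[k]$ be the polynomial ring over $\mathbb{C}$ in these $4N$ variables, and put $Q_i = a_i d_i - b_i c_i$. Let $v_i, w_i$, $1 \le i \le N$, be column vectors with two components each, all components being independent variables, and let $\mathbb{C}[v,w]$ be the polynomial ring over $\mathbb{C}$ in these $4N$ variables. Consider the ideals $$I_N = (k_1 + \dots + k_N,\ Q_1, \dots, Q_N) \subset \mathbb{C}[k], \qquad I'_N = (v_1 w_1^T + \dots + v_N w_N^T) \subset \mathbb{C}[v,w],$$ where a matrix listed among the generators stands for its four entries. Then $I_N$ and $I'_N$ are prime ideals, and the quotient rings $\mathbb{C}[k]/I_N$ and $\mathbb{C}[v,w]/I'_N$ are normal Noetherian domains, that is, Noetherian integral domains that are integrally closed in their fraction fields. -/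

import Mathlib

noncomputable section

/-- The polynomial ring `ℂ[k₁, …, k_N]` in `4N` variables, where `k_i` stands for the four
entries of a `2 × 2` matrix. -/
abbrev MomentumRing (N : ℕ) : Type := MvPolynomial (Fin N × Fin 2 × Fin 2) ℂ

/-- The polynomial ring `ℂ[v₁, w₁, …, v_N, w_N]` in `4N` variables, where each of `v_i` and `w_i`
stands for two variables. The left summand indexes the `v`'s, the right summand the `w`'s. -/
abbrev SpinorRing (N : ℕ) : Type := MvPolynomial ((Fin N × Fin 2) ⊕ (Fin N × Fin 2)) ℂ

/-- The generic `2 × 2` matrix `k_i`, with entries `a_i, b_i` (first row), `c_i, d_i`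
(second row). -/
def momentum {N : ℕ} (i : Fin N) : Matrix (Fin 2) (Fin 2) (MomentumRing N) :=
  Matrix.of fun r s => MvPolynomial.X (i, r, s)

/-- The quadric `Q_i = a_i d_i - b_i c_i`. -/
def coneQuadric {N : ℕ} (i : Fin N) : MomentumRing N :=
  momentum i 0 0 * momentum i 1 1 - momentum i 0 1 * momentum i 1 0

/-- The generic spinor `v_i`. -/
def spinorV {N : ℕ} (i : Fin N) : Fin 2 → SpinorRing N :=
  fun r => MvPolynomial.X (Sum.inl (i, r))

/-- The generic spinor `w_i`. -/
def spinorW {N : ℕ} (i : Fin N) : Fin 2 → SpinorRing N :=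
  fun r => MvPolynomial.X (Sum.inr (i, r))

/-- The ideal `I_N = (k₁ + ⋯ + k_N, Q₁, …, Q_N)`, generated by the four entries of the matrix
`k₁ + ⋯ + k_N` and by the quadrics `Q_i`. -/
def momentumIdeal (N : ℕ) : Ideal (MomentumRing N) :=
  Ideal.span
    (Set.range (fun e : Fin 2 × Fin 2 => (∑ i : Fin N, momentum i) e.1 e.2) ∪
      Set.range (fun i : Fin N => coneQuadric i))

/-- The ideal `I'_N = (v₁ w₁ᵀ + ⋯ + v_N w_Nᵀ)`, generated by the four entries of this matrix. -/
def spinorIdeal (N : ℕ) : Ideal (SpinorRing N) :=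
  Ideal.span
    (Set.range (fun e : Fin 2 × Fin 2 =>
      (∑ i : Fin N, Matrix.vecMulVec (spinorV i) (spinorW i)) e.1 e.2))

end

/-! Spinors. Consider `Vᵀ * W = 0` with `V` of size `M × p` and `W` of size `M × q`, `p, q ≤ 2` and
`p + q ≤ M`, over a factorial base, and induct on `p + q`. Where `v 0 0` is invertible, a column
operation clears the rest of its row, the first row of `W` is determined by the others, and what
remains is the same problem for `(M - 1, p - 1, q)` over a polynomial ring (`hasNormalChart_v`); `w
0 0` is symmetric. The pair `v 0 0, w 0 0` is a regular sequence on the quotient, so the two normal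
charts glue as in Hartogs' theorem (`isDomain_and_isIntegrallyClosed_of_normalCharts`).

Regularity comes from a degeneration (`isWeaklyRegular_bilinearForm`): modulo all but `2pq` suitably
chosen variables, the forms become monomials `v * w` in disjoint variables, and a regular sequence
of homogeneous elements of positive degree may be permuted.

Momenta. Put `k_i = v_i w_iᵀ`. The torus scaling `v_i` by `t_i` and `w_i` by `t_i⁻¹` has a
projection onto invariants, which descends to a `ℂ[k]/I_N`-linear retraction of `ℂ[v,w]/I'_N` onto
`ℂ[k]/I_N`. Being a normal domain passes down along such a retraction
(`isDomain_and_isIntegrallyClosed_of_retraction`). -/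

/-! ### Normality: gluing two charts, descent along a retraction. -/

theorem map_dvd_map_of_isIntegral {A E : Type*} [CommRing A] [IsDomain A] [CommRing E] [IsDomain E]
    [IsIntegrallyClosed E] (ψ : A →+* E) (hψ : Function.Injective ψ) {a b : A} (hb : b ≠ 0)
    (h : IsIntegral A (algebraMap A (FractionRing A) a / algebraMap A (FractionRing A) b)) :
    ψ b ∣ ψ a := by
  have hinj : Function.Injective ((algebraMap E (FractionRing E)).comp ψ) :=
    (IsFractionRing.injective E (FractionRing E)).comp hψ
  set g : FractionRing A →+* FractionRing E := IsFractionRing.lift hinj with hg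
  have hint : IsIntegral E
      (g (algebraMap A (FractionRing A) a / algebraMap A (FractionRing A) b)) := by
    obtain ⟨P, hP, hP0⟩ := h
    refine ⟨P.map ψ, hP.map _, ?_⟩
    have h1 := congrArg g hP0
    rw [Polynomial.hom_eval₂, map_zero] at h1
    rw [Polynomial.eval₂_map, ← h1]
    congr 1
    ext z
    simp [hg, IsFractionRing.lift_algebraMap]
  obtain ⟨e, he⟩ := IsIntegrallyClosed.isIntegral_iff.mp hint
  refine ⟨e, IsFractionRing.injective E (FractionRing E) ?_⟩
  have hb' : algebraMap E (FractionRing E) (ψ b) ≠ 0 := by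
    intro h0
    exact hb (hinj (by simpa using h0))
  rw [map_mul, he, map_div₀]
  simp only [hg, IsFractionRing.lift_algebraMap, RingHom.comp_apply]
  field_simp

theorem isIntegrallyClosed_of_forall_dvd {A : Type*} [CommRing A] [IsDomain A]
    (H : ∀ a b : A, b ≠ 0 →
      IsIntegral A (algebraMap A (FractionRing A) a / algebraMap A (FractionRing A) b) → b ∣ a) :
    IsIntegrallyClosed A := by
  rw [isIntegrallyClosed_iff (FractionRing A)]
  intro z hz
  obtain ⟨a, b, hb, rfl⟩ := IsFractionRing.div_surjective (A := A) z
  have hb0 : b ≠ 0 := nonZeroDivisors.ne_zero hb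
  obtain ⟨c, rfl⟩ := H a b hb0 hz
  refine ⟨c, ?_⟩
  have : algebraMap A (FractionRing A) b ≠ 0 := by simpa using hb0
  rw [map_mul]
  field_simp

/-- A normal domain `E` under `A` that agrees with `A` after inverting `x`. -/
def HasNormalChart (A : Type*) [CommRing A] (x : A) : Prop :=
  ∃ (E : Type) (_ : CommRing E) (_ : IsDomain E) (_ : IsIntegrallyClosed E) (ψ : A →+* E),
    (∀ z, ψ z = 0 → ∃ n : ℕ, x ^ n * z = 0) ∧ ∀ e, ∃ (n : ℕ) (z : A), ψ x ^ n * e = ψ z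

theorem HasNormalChart.of_ringEquiv {A B : Type*} [CommRing A] [CommRing B] (f : A ≃+* B) {x : A}
    (h : HasNormalChart B (f x)) : HasNormalChart A x := by
  obtain ⟨E, _, _, _, ψ, h1, h2⟩ := h
  refine ⟨E, ‹_›, ‹_›, ‹_›, ψ.comp (f : A →+* B), fun z hz => ?_, fun e => ?_⟩
  · obtain ⟨n, hn⟩ := h1 (f z) hz
    exact ⟨n, f.injective (by simpa using hn)⟩
  · obtain ⟨n, z, hz⟩ := h2 e
    exact ⟨n, f.symm z, by simpa using hz⟩

/-- If `a / b` is integral, the charts give `x ^ n * a = b * c` and `y ^ m * a = b * d`. Then `y ^ m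
* c = x ^ n * d`, so regularity of `x, y` forces `x ^ n ∣ c`, and cancelling `x ^ n` gives `b ∣ a`.
-/
theorem isDomain_and_isIntegrallyClosed_of_normalCharts {A : Type*} [CommRing A] {x y : A}
    (hx : ∀ z, x * z = 0 → z = 0) (hy : ∀ z, y * z = 0 → z = 0)
    (hxy : ∀ c d, y * c = x * d → x ∣ c)
    (cx : HasNormalChart A x) (cy : HasNormalChart A y) :
    IsDomain A ∧ IsIntegrallyClosed A := by
  have hpow : ∀ {x : A}, (∀ z, x * z = 0 → z = 0) → ∀ (n : ℕ) (z : A), x ^ n * z = 0 → z = 0 := by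
    intro x hx n
    induction n with
    | zero => simp
    | succ n ih => exact fun z hz => ih z (hx _ (by rw [← hz]; ring))
  have key : ∀ {x : A}, (∀ z, x * z = 0 → z = 0) → HasNormalChart A x → IsDomain A ∧
      ∀ [IsDomain A], ∀ a b : A, b ≠ 0 → IsIntegral A
        (algebraMap A (FractionRing A) a / algebraMap A (FractionRing A) b) →
        ∃ n : ℕ, b ∣ x ^ n * a := by
    intro x hx cx
    obtain ⟨E, _, _, _, ψ, h1, h2⟩ := cx
    have hinj : Function.Injective ψ := by
      rw [injective_iff_map_eq_zero]
      intro z hz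
      obtain ⟨n, hn⟩ := h1 z hz
      exact hpow hx n z hn
    refine ⟨hinj.isDomain ψ, fun a b hb hab => ?_⟩
    obtain ⟨e, he⟩ := map_dvd_map_of_isIntegral ψ hinj hb hab
    obtain ⟨n, z, hz⟩ := h2 e
    refine ⟨n, z, hinj ?_⟩
    rw [map_mul, map_mul, map_pow, he, ← hz]
    ring
  obtain ⟨hA, kx⟩ := key hx cx
  refine ⟨hA, isIntegrallyClosed_of_forall_dvd fun a b hb hab => ?_⟩
  obtain ⟨n, c, hc⟩ := kx a b hb hab
  obtain ⟨m, d, hd⟩ := (key hy cy).2 a b hb hab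
  have hcd : y ^ m * c = x ^ n * d := by
    apply mul_left_cancel₀ hb
    calc b * (y ^ m * c) = y ^ m * (b * c) := by ring
      _ = x ^ n * (b * d) := by rw [← hc, ← hd]; ring
      _ = _ := by ring
  have hy1 : ∀ (m : ℕ) (c d : A), y ^ m * c = x * d → x ∣ c := by
    intro m
    induction m with
    | zero => exact fun c d h => ⟨d, by simpa using h⟩
    | succ m ih =>
      intro c d h
      obtain ⟨d', hd'⟩ := hxy (y ^ m * c) d (by rw [← h]; ring)
      exact ih c d' hd'
  have hx1 : ∀ (n : ℕ) (c d : A), y ^ m * c = x ^ n * d → x ^ n ∣ c := by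
    intro n
    induction n with
    | zero => exact fun c d _ => by simp
    | succ n ih =>
      intro c d h
      obtain ⟨c', rfl⟩ := hy1 m c (x ^ n * d) (by rw [h]; ring)
      have : y ^ m * c' = x ^ n * d := by
        rw [← sub_eq_zero]
        apply hx
        rw [mul_sub, sub_eq_zero]
        calc x * (y ^ m * c') = y ^ m * (x * c') := by ring
          _ = _ := by rw [h]; ring
      rw [pow_succ']
      exact mul_dvd_mul_left x (ih c' d this)
  obtain ⟨c', rfl⟩ := hx1 n c d hcd
  refine ⟨c', ?_⟩
  rw [← sub_eq_zero]
  apply hpow hx n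
  rw [mul_sub, hc]
  ring

/-- Applying `ρ` to `φ a = φ b * e` gives `a = b * ρ e`, so divisibility in `A` descends to `B`. -/
theorem isDomain_and_isIntegrallyClosed_of_retraction {A B : Type*} [CommRing A] [CommRing B]
    [IsDomain A] [IsIntegrallyClosed A] (φ : B →+* A) (ρ : A → B)
    (hρ : ∀ b c, ρ (φ b * c) = b * ρ c) (h1 : ρ 1 = 1) :
    IsDomain B ∧ IsIntegrallyClosed B := by
  have hleft : ∀ b, ρ (φ b) = b := fun b => by simpa [h1] using hρ b 1
  have hinj : Function.Injective φ := Function.LeftInverse.injective hleft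
  have hB : IsDomain B := hinj.isDomain φ
  refine ⟨hB, isIntegrallyClosed_of_forall_dvd fun a b hb hab => ?_⟩
  obtain ⟨e, he⟩ := map_dvd_map_of_isIntegral φ hinj hb hab
  exact ⟨ρ e, by rw [← hρ, ← he, hleft]⟩

/-! ### Regular sequences in polynomial rings. -/

open RingTheory.Sequence in
theorem isWeaklyRegular_self_iff {R : Type*} [CommRing R] (rs : List R) :
    IsWeaklyRegular R rs ↔ ∀ i (h : i < rs.length), ∀ g : R,
      rs[i] * g ∈ Ideal.ofList (rs.take i) → g ∈ Ideal.ofList (rs.take i) := by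
  rw [isWeaklyRegular_iff]
  refine forall₂_congr fun i h => ?_
  rw [isSMulRegular_quotient_iff_mem_of_smul_mem]
  simp

open RingTheory.Sequence in
theorem mem_ofList_of_mul_mem {R : Type*} [CommRing R] {rs ts : List R} {x g : R}
    (h : IsWeaklyRegular R (rs ++ x :: ts)) (hg : x * g ∈ Ideal.ofList rs) :
    g ∈ Ideal.ofList rs := by
  have := (isWeaklyRegular_self_iff _).mp h rs.length (by simp) g
  simpa using this (by simpa using hg)

theorem Finsupp.disjoint_nat_iff {σ : Type*} {s t : σ →₀ ℕ} :
    Disjoint s t ↔ ∀ i, s i = 0 ∨ t i = 0 := by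
  rw [_root_.disjoint_iff, DFunLike.ext_iff]
  refine forall_congr' fun i => ?_
  rw [Finsupp.inf_apply, bot_eq_zero, Finsupp.coe_zero, Pi.zero_apply]
  omega

namespace MvPolynomial

open RingTheory.Sequence

variable {σ K : Type*} [CommRing K]

/-- Membership in a monomial ideal is tested term by term, and a factor in variables disjoint from
`s` does not help `s` divide a term. -/
theorem mem_span_monomial_of_monomial_mul_mem {S : Set (σ →₀ ℕ)} {m : σ →₀ ℕ}
    (hm : ∀ s ∈ S, Disjoint s m) {g : MvPolynomial σ K}
    (hg : monomial m 1 * g ∈ Ideal.span ((fun s => monomial s (1 : K)) '' S)) :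
    g ∈ Ideal.span ((fun s => monomial s (1 : K)) '' S) := by
  rw [mem_ideal_span_monomial_image] at hg ⊢
  intro d hd
  obtain ⟨s, hs, hsd⟩ := hg (m + d) (by simpa [mem_support_iff, coeff_monomial_mul] using hd)
  refine ⟨s, hs, fun i => ?_⟩
  have h1 := hsd i
  have h2 := Finsupp.disjoint_nat_iff.mp (hm s hs) i
  rw [Finsupp.add_apply] at h1
  omega

theorem isWeaklyRegular_monomial {l : List (σ →₀ ℕ)} (hl : l.Pairwise Disjoint) :
    IsWeaklyRegular (MvPolynomial σ K) (l.map fun s => monomial s (1 : K)) := by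
  rw [isWeaklyRegular_self_iff]
  intro i hi g hg
  have hset : Ideal.ofList ((l.map fun s => monomial s (1 : K)).take i) =
      Ideal.span ((fun s => monomial s (1 : K)) '' {s | s ∈ l.take i}) := by
    rw [Ideal.ofList]
    congr 1
    ext
    rw [← List.map_take]
    simp only [List.mem_map, Set.mem_image, Set.mem_ofPred_eq]
  rw [hset] at hg ⊢
  rw [List.getElem_map] at hg
  refine mem_span_monomial_of_monomial_mul_mem (fun s hs => ?_) hg
  obtain ⟨j, hj, rfl⟩ := List.mem_take_iff_getElem.mp hs
  exact List.pairwise_iff_getElem.mp hl j i _ _ (by omega)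

attribute [local instance] MvPolynomial.gradedAlgebra in
-- A graded Nakayama argument: a class divisible by every power of an element `a` without constant
-- term vanishes modulo a homogeneous ideal.
theorem isWeaklyRegular_of_perm {rs rs' : List (MvPolynomial σ K)}
    (h : IsWeaklyRegular (MvPolynomial σ K) rs) (hp : rs.Perm rs')
    (hhom : ∀ r ∈ rs, ∃ n, r.IsHomogeneous n) (hvars : ∀ r ∈ rs, r ∈ idealOfVars σ K) :
    IsWeaklyRegular (MvPolynomial σ K) rs' := by
  refine h.prototype_perm hp fun a b ts hts => ?_
  intro N hN
  rw [eq_bot_iff]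
  intro z hz
  have hpow : ∀ n : ℕ, ∃ y, z = a ^ n • y ∧ y ∈ N := by
    intro n
    induction n with
    | zero => exact ⟨z, by simp, hz⟩
    | succ n ih =>
      obtain ⟨y, rfl, hy⟩ := ih
      rw [hN] at hy
      obtain ⟨y', hy', rfl⟩ := Submodule.mem_smul_pointwise_iff_exists _ _ _ |>.mp hy
      exact ⟨y', by rw [smul_smul, pow_succ], hy'⟩
  have htop : (Ideal.ofList ts • ⊤ : Submodule (MvPolynomial σ K) (MvPolynomial σ K)) =
      Ideal.ofList ts := by simp
  have hhomI : (Ideal.ofList ts).IsHomogeneous (homogeneousSubmodule σ K) := by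
    refine Ideal.homogeneous_span _ _ fun r hr => ?_
    exact hhom r (hts.subset (by simp only [List.mem_cons]; exact Or.inr (Or.inr hr)))
  have ha : a ∈ idealOfVars σ K := hvars a (hts.subset (by simp))
  obtain ⟨g, rfl⟩ := Submodule.Quotient.mk_surjective _ z
  rw [Submodule.mem_bot, Submodule.Quotient.mk_eq_zero, htop,
    mem_iff_homogeneousComponent_mem hhomI]
  intro d
  obtain ⟨y, hy, -⟩ := hpow (d + 1)
  obtain ⟨k, rfl⟩ := Submodule.Quotient.mk_surjective _ y
  rw [← Submodule.Quotient.mk_smul, Submodule.Quotient.eq, htop] at hy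
  have h1 := homogeneousComponent_mem_of_mem hhomI hy d
  have h2 : a ^ (d + 1) • k ∈ idealOfVars σ K ^ (d + 1) := by
    rw [smul_eq_mul]
    exact Ideal.mul_mem_right _ _ (Ideal.pow_mem_pow ha _)
  have h3 : homogeneousComponent d (a ^ (d + 1) • k) = 0 := by
    -- All terms of `a ^ (d + 1) • k` have degree at least `d + 1`.
    apply homogeneousComponent_eq_zero'
    intro x hx
    have := (mem_pow_idealOfVars_iff _ _).mp h2 x hx
    omega
  rwa [map_sub, h3, sub_zero] at h1

/-- With the variables of `T` placed first, each `f i` acts on the quotient as its monomial `m i`,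
so disjointness suffices; the order is then reversed by homogeneity. -/
theorem isWeaklyRegular_append_X {ι : Type*} (L : List ι) (f : ι → MvPolynomial σ K)
    (m : ι → σ →₀ ℕ) (T : List σ) (hT : T.Nodup) (hm : (L.map m).Pairwise Disjoint)
    (hmT : ∀ i ∈ L, ∀ t ∈ T, m i t = 0)
    (hf : ∀ i ∈ L, f i - monomial (m i) 1 ∈ Ideal.span (X '' {t | t ∈ T}))
    (hhom : ∀ i ∈ L, ∃ n, (f i).IsHomogeneous n) (hvars : ∀ i ∈ L, f i ∈ idealOfVars σ K) :
    IsWeaklyRegular (MvPolynomial σ K) (L.map f ++ T.map X) := by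
  have hmon : IsWeaklyRegular (MvPolynomial σ K)
      (T.map X ++ L.map fun i => monomial (m i) (1 : K)) := by
    have : T.map X ++ L.map (fun i => monomial (m i) (1 : K)) =
        (T.map (fun t => Finsupp.single t 1) ++ L.map m).map fun s => monomial s (1 : K) := by
      simp [X, Function.comp_def]
    rw [this]
    refine isWeaklyRegular_monomial (List.pairwise_append.mpr ⟨?_, hm, ?_⟩)
    · rw [List.pairwise_map]
      refine hT.imp fun {a b} hab => ?_
      rw [Finsupp.disjoint_nat_iff]
      intro i
      by_cases h : i = a
      · exact Or.inr (Finsupp.single_eq_of_ne (h ▸ hab))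
      · exact Or.inl (Finsupp.single_eq_of_ne h)
    · simp only [List.mem_map, forall_exists_index, and_imp]
      rintro _ t ht rfl _ i hi rfl
      rw [Finsupp.disjoint_nat_iff]
      intro j
      by_cases h : j = t
      · exact Or.inr (h ▸ hmT i hi t ht)
      · exact Or.inl (Finsupp.single_eq_of_ne h)
  have hreg : IsWeaklyRegular (MvPolynomial σ K) (T.map X ++ L.map f) := by
    rw [isWeaklyRegular_append_iff] at hmon ⊢
    refine ⟨hmon.1, ?_⟩
    refine (AddEquiv.isWeaklyRegular_congr (e := AddEquiv.refl _) ?_).mp hmon.2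
    rw [List.forall₂_map_left_iff, List.forall₂_map_right_iff, List.forall₂_same]
    intro i hi z
    obtain ⟨g, rfl⟩ := Submodule.Quotient.mk_surjective _ z
    simp only [AddEquiv.refl_apply]
    rw [← Submodule.Quotient.mk_smul, ← Submodule.Quotient.mk_smul, eq_comm,
      Submodule.Quotient.eq, ← sub_smul]
    have h1 : f i - monomial (m i) 1 ∈ Ideal.ofList (T.map X) := by
      convert hf i hi using 2
      ext; simp
    exact Submodule.smul_mem_smul h1 trivial
  refine isWeaklyRegular_of_perm hreg List.perm_append_comm ?_ ?_
  · simp only [List.mem_append, List.mem_map]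
    rintro r (⟨t, -, rfl⟩ | ⟨i, hi, rfl⟩)
    · exact ⟨1, isHomogeneous_X _ _⟩
    · exact hhom i hi
  · simp only [List.mem_append, List.mem_map]
    rintro r (⟨t, -, rfl⟩ | ⟨i, hi, rfl⟩)
    · exact Ideal.subset_span ⟨t, rfl⟩
    · exact hvars i hi

end MvPolynomial

theorem mul_eq_zero_and_dvd_of_isWeaklyRegular {R : Type*} [CommRing R] {I : Ideal R}
    {rs ts : List R} {x y : R} (hI : I = Ideal.ofList rs)
    (h : RingTheory.Sequence.IsWeaklyRegular R (rs ++ x :: y :: ts)) :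
    (∀ z : R ⧸ I, Ideal.Quotient.mk I x * z = 0 → z = 0) ∧
      ∀ c d : R ⧸ I, Ideal.Quotient.mk I y * c = Ideal.Quotient.mk I x * d →
        Ideal.Quotient.mk I x ∣ c := by
  subst hI
  constructor
  · intro z hz
    obtain ⟨g, rfl⟩ := Ideal.Quotient.mk_surjective z
    rw [← map_mul, Ideal.Quotient.eq_zero_iff_mem] at hz
    rw [Ideal.Quotient.eq_zero_iff_mem]
    exact mem_ofList_of_mul_mem h hz
  · intro c d hcd
    obtain ⟨c, rfl⟩ := Ideal.Quotient.mk_surjective c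
    obtain ⟨d, rfl⟩ := Ideal.Quotient.mk_surjective d
    rw [← map_mul, ← map_mul, Ideal.Quotient.eq] at hcd
    have h' : RingTheory.Sequence.IsWeaklyRegular R ((rs ++ [x]) ++ y :: ts) := by simpa using h
    have hmem : y * c ∈ Ideal.ofList (rs ++ [x]) := by
      rw [Ideal.ofList_append, Ideal.ofList_singleton]
      have h1 : y * c = (y * c - x * d) + d * x := by ring
      rw [h1]
      exact add_mem (Ideal.mem_sup_left hcd)
        (Ideal.mem_sup_right (Ideal.mul_mem_left _ _ (Ideal.mem_span_singleton_self x)))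
    have h2 := mem_ofList_of_mul_mem h' hmem
    rw [Ideal.ofList_append, Ideal.ofList_singleton, Submodule.mem_sup] at h2
    obtain ⟨a, ha, b, hb, rfl⟩ := h2
    obtain ⟨e, rfl⟩ := Ideal.mem_span_singleton.mp hb
    refine ⟨Ideal.Quotient.mk _ e, ?_⟩
    rw [map_add, Ideal.Quotient.eq_zero_iff_mem.mpr ha, zero_add, map_mul]

/-! ### The variety `Vᵀ * W = 0` and its charts. -/

noncomputable section

open MvPolynomial

/-- The generic bilinear form `∑ i, v i r * w i s`. -/
def bilinearForm (K : Type*) [CommRing K] (M p q : ℕ) (e : Fin p × Fin q) :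
    MvPolynomial ((Fin M × Fin p) ⊕ (Fin M × Fin q)) K :=
  ∑ i, X (Sum.inl (i, e.1)) * X (Sum.inr (i, e.2))

/-- The ideal of the variety of pairs of matrices `V`, `W` with `Vᵀ * W = 0`. -/
def bilinearIdeal (K : Type*) [CommRing K] (M p q : ℕ) :
    Ideal (MvPolynomial ((Fin M × Fin p) ⊕ (Fin M × Fin q)) K) :=
  Ideal.span (Set.range (bilinearForm K M p q))

/-- The coordinate ring of the variety of pairs of matrices `V`, `W` with `Vᵀ * W = 0`. -/
def BilinearQuotient (K : Type*) [CommRing K] (M p q : ℕ) : Type _ :=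
  MvPolynomial ((Fin M × Fin p) ⊕ (Fin M × Fin q)) K ⧸ bilinearIdeal K M p q

namespace BilinearQuotient

variable (K : Type*) [CommRing K] (M p q : ℕ)

instance : CommRing (BilinearQuotient K M p q) :=
  inferInstanceAs (CommRing (_ ⧸ bilinearIdeal K M p q))

/-- The quotient map. -/
def mk : MvPolynomial ((Fin M × Fin p) ⊕ (Fin M × Fin q)) K →+* BilinearQuotient K M p q :=
  Ideal.Quotient.mk _

/-- The structure map from the coefficients. -/
def ofBase : K →+* BilinearQuotient K M p q := (mk K M p q).comp C

variable {M p q}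

/-- The generic entries of the first matrix. -/
def v (i : Fin M) (r : Fin p) : BilinearQuotient K M p q :=
  mk K M p q (X (Sum.inl (i, r)))

/-- The generic entries of the second matrix. -/
def w (i : Fin M) (s : Fin q) : BilinearQuotient K M p q :=
  mk K M p q (X (Sum.inr (i, s)))

theorem sum_v_mul_w (r : Fin p) (s : Fin q) : ∑ i : Fin M, v K i r * w K i s = 0 := by
  have : mk K M p q (bilinearForm K M p q (r, s)) = 0 :=
    Ideal.Quotient.eq_zero_iff_mem.mpr (Ideal.subset_span ⟨_, rfl⟩)
  simpa only [bilinearForm, v, w, map_sum, map_mul] using this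

variable {K} {T : Type*} [CommRing T]

theorem exists_lift (g : K →+* T) (V : Fin M → Fin p → T) (W : Fin M → Fin q → T)
    (h : ∀ r s, ∑ i, V i r * W i s = 0) : ∃ f : BilinearQuotient K M p q →+* T,
      (∀ k, f (ofBase K M p q k) = g k) ∧ (∀ i r, f (v K i r) = V i r) ∧
      ∀ i s, f (w K i s) = W i s := by
  let F := eval₂Hom g (Sum.elim (fun x : Fin M × Fin p => V x.1 x.2)
    (fun x : Fin M × Fin q => W x.1 x.2))
  have hF : bilinearIdeal K M p q ≤ RingHom.ker F := by
    rw [bilinearIdeal, Ideal.span_le]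
    rintro _ ⟨⟨r, s⟩, rfl⟩
    simpa [F, bilinearForm, RingHom.mem_ker] using h r s
  have hlift : ∀ P, Ideal.Quotient.lift _ F hF (mk K M p q P) = F P :=
    fun P => Ideal.Quotient.lift_mk _ _ _
  refine ⟨Ideal.Quotient.lift _ F hF, fun k => ?_, fun i r => ?_, fun i s => ?_⟩
  · exact (hlift _).trans (by simp [F])
  · exact (hlift _).trans (by simp [F])
  · exact (hlift _).trans (by simp [F])

theorem mk_surjective : Function.Surjective (mk K M p q) := Ideal.Quotient.mk_surjective

theorem ringHom_ext {f g : BilinearQuotient K M p q →+* T}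
    (h0 : ∀ k, f (ofBase K M p q k) = g (ofBase K M p q k))
    (hv : ∀ i r, f (v K i r) = g (v K i r)) (hw : ∀ i s, f (w K i s) = g (w K i s)) : f = g := by
  refine Ideal.Quotient.ringHom_ext (MvPolynomial.ringHom_ext h0 ?_)
  rintro (⟨i, r⟩ | ⟨i, s⟩)
  · exact hv i r
  · exact hw i s

theorem induction_on {P : BilinearQuotient K M p q → Prop} (z : BilinearQuotient K M p q)
    (h0 : ∀ k, P (ofBase K M p q k)) (hv : ∀ i r, P (v K i r)) (hw : ∀ i s, P (w K i s))
    (hadd : ∀ a b, P a → P b → P (a + b)) (hmul : ∀ a b, P a → P b → P (a * b)) : P z := by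
  obtain ⟨f, rfl⟩ := mk_surjective z
  induction f using MvPolynomial.induction_on with
  | C a => exact h0 a
  | add f g hf hg => rw [map_add]; exact hadd _ _ hf hg
  | mul_X f i hf =>
    rw [map_mul]
    refine hmul _ _ hf ?_
    rcases i with ⟨i, r⟩ | ⟨i, s⟩
    · exact hv i r
    · exact hw i s

variable (K M p q) in
theorem exists_swap : ∃ e : BilinearQuotient K M p q ≃+* BilinearQuotient K M q p,
    ∀ i s, e (w K i s) = v K i s := by
  have h : ∀ (p q : ℕ) (r : Fin p) (s : Fin q), ∑ i : Fin M, w K i r * v K i s = 0 := by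
    intro p q r s
    rw [← sum_v_mul_w K s r]
    exact Finset.sum_congr rfl fun i _ => mul_comm _ _
  obtain ⟨f, f0, fv, fw⟩ := exists_lift (ofBase K M q p) (w K) (v K) (h p q)
  obtain ⟨g, g0, gv, gw⟩ := exists_lift (ofBase K M p q) (w K) (v K) (h q p)
  refine ⟨RingEquiv.ofRingHom f g ?_ ?_, fw⟩
  · exact ringHom_ext (by simp [f0, g0]) (by simp [gv, fw]) (by simp [gw, fv])
  · exact ringHom_ext (by simp [f0, g0]) (by simp [gw, fv]) (by simp [gv, fw])

variable (K M p) in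
/-- The parameters of the chart where the corner entry of `V` is invertible: this entry, the rest
of its row, and the ratios to it of the rest of its column. -/
abbrev ChartBase : Type _ := MvPolynomial (Option (Fin M ⊕ Fin p)) K

/-- Writing the first row of `V` as `a, a * c r` and the later rows of `W` as `a * w'` solves for
the first row of `W` without inverting `a`, so the chart stays over a polynomial ring. -/
theorem exists_chartHom (g : K →+* T) (a : T) (b : Fin M → T) (c : Fin p → T)
    (v' : Fin M → Fin p → T) (w' : Fin M → Fin q → T) (h : ∀ r s, ∑ j, v' j r * w' j s = 0) :
    ∃ ψ : BilinearQuotient K (M + 1) (p + 1) q →+* T,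
      (∀ k, ψ (ofBase K _ _ _ k) = g k) ∧ ψ (v K 0 0) = a ∧
      (∀ r : Fin p, ψ (v K 0 r.succ) = a * c r) ∧ (∀ j : Fin M, ψ (v K j.succ 0) = b j) ∧
      (∀ (j : Fin M) (r : Fin p), ψ (v K j.succ r.succ) = v' j r + c r * b j) ∧
      (∀ s, ψ (w K 0 s) = -∑ j, b j * w' j s) ∧
      ∀ (j : Fin M) s, ψ (w K j.succ s) = a * w' j s := by
  let V : Fin (M + 1) → Fin (p + 1) → T := fun i r =>
    Fin.cases (Fin.cases a (fun r => a * c r) r)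
      (fun j => Fin.cases (b j) (fun r => v' j r + c r * b j) r) i
  let W : Fin (M + 1) → Fin q → T := fun i s =>
    Fin.cases (-∑ j, b j * w' j s) (fun j => a * w' j s) i
  have hVW : ∀ r s, ∑ i, V i r * W i s = 0 := by
    intro r s
    rw [Fin.sum_univ_succ]
    refine Fin.cases ?_ (fun r => ?_) r
    · simp only [V, W, Fin.cases_zero, Fin.cases_succ, mul_neg, Finset.mul_sum]
      rw [neg_add_eq_zero]
      exact Finset.sum_congr rfl fun j _ => by ring
    · simp only [V, W, Fin.cases_zero, Fin.cases_succ, mul_neg, Finset.mul_sum]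
      have h1 := congrArg (a * ·) (h r s)
      simp only [mul_zero, Finset.mul_sum] at h1
      rw [neg_add_eq_zero, ← sub_eq_zero, ← Finset.sum_sub_distrib, ← neg_eq_zero, ← h1,
        ← Finset.sum_neg_distrib]
      exact Finset.sum_congr rfl fun j _ => by ring
  obtain ⟨ψ, h0, hv, hw⟩ := exists_lift g V W hVW
  exact ⟨ψ, h0, hv _ _, fun _ => hv _ _, fun _ => hv _ _, fun _ _ => hv _ _, fun _ => hw _ _,
    fun _ _ => hw _ _⟩

/-- The reduced `V` is the Schur complement of the corner: the column operation makes the first row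
vanish off the corner, so that row drops out of the relations. -/
theorem exists_chartInv (f : BilinearQuotient K (M + 1) (p + 1) q →+* T) (y : T)
    (hy : f (v K 0 0) * y = 1) :
    ∃ χ : BilinearQuotient (ChartBase K M p) M p q →+* T,
      (∀ k, χ (ofBase _ _ _ _ (C k)) = f (ofBase K _ _ _ k)) ∧
      χ (ofBase _ _ _ _ (X none)) = f (v K 0 0) ∧
      (∀ j, χ (ofBase _ _ _ _ (X (some (Sum.inl j)))) = f (v K j.succ 0)) ∧
      (∀ r, χ (ofBase _ _ _ _ (X (some (Sum.inr r)))) = f (v K 0 r.succ) * y) ∧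
      (∀ j r, χ (v _ j r) = f (v K j.succ r.succ) - f (v K 0 r.succ) * y * f (v K j.succ 0)) ∧
      ∀ j s, χ (w _ j s) = f (w K j.succ s) * y := by
  let γ : ChartBase K M p →+* T := eval₂Hom (f.comp (ofBase K _ _ _)) (fun o => o.elim (f (v K 0 0))
    (Sum.elim (fun j => f (v K j.succ 0)) (fun r => f (v K 0 r.succ) * y)))
  obtain ⟨χ, h0, hv, hw⟩ := exists_lift γ
    (fun j r => f (v K j.succ r.succ) - f (v K 0 r.succ) * y * f (v K j.succ 0))
    (fun (j : Fin M) (s : Fin q) => f (w K j.succ s) * y) (by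
      intro r s
      have h1 := congrArg f (sum_v_mul_w K (M := M + 1) (p := p + 1) (q := q) 0 s)
      have h2 := congrArg f (sum_v_mul_w K (M := M + 1) (p := p + 1) (q := q) r.succ s)
      rw [Fin.sum_univ_succ, map_zero, map_add, map_sum, map_mul] at h1 h2
      simp only [map_mul] at h1 h2
      have h3 : ∀ j : Fin M, (f (v K j.succ r.succ) - f (v K 0 r.succ) * y * f (v K j.succ 0)) *
          (f (w K j.succ s) * y) = y * (f (v K j.succ r.succ) * f (w K j.succ s)) -
          f (v K 0 r.succ) * y * y * (f (v K j.succ 0) * f (w K j.succ s)) := fun j => by ring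
      simp only [h3]
      rw [Finset.sum_sub_distrib, ← Finset.mul_sum, ← Finset.mul_sum,
        eq_neg_of_add_eq_zero_right h1, eq_neg_of_add_eq_zero_right h2]
      linear_combination (f (v K 0 r.succ) * y * f (w K 0 s)) * hy)
  refine ⟨χ, fun k => ?_, ?_, fun j => ?_, fun r => ?_, hv, hw⟩ <;> simp [h0, γ]

theorem hasNormalChart_v {K : Type} [CommRing K]
    [IsDomain (BilinearQuotient (ChartBase K M p) M p q)]
    [IsIntegrallyClosed (BilinearQuotient (ChartBase K M p) M p q)] :
    HasNormalChart (BilinearQuotient K (M + 1) (p + 1) q) (v K 0 0) := by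
  let β : ChartBase K M p →+* BilinearQuotient (ChartBase K M p) M p q := ofBase _ M p q
  obtain ⟨ψ, ψ0, ψv, ψr, ψj, ψjr, ψw, ψwj⟩ := exists_chartHom (K := K) (M := M) (p := p) (q := q)
    (β.comp C) (β (X none)) (fun j => β (X (some (Sum.inl j))))
    (fun r => β (X (some (Sum.inr r)))) (v _) (w _) (sum_v_mul_w _)
  refine ⟨_, inferInstance, ‹_›, ‹_›, ψ, fun z hz => ?_, fun e => ?_⟩
  · let A := BilinearQuotient K (M + 1) (p + 1) q
    let ι := algebraMap A (Localization.Away (v K 0 0 : A))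
    obtain ⟨y, hy⟩ : ∃ y, ι (v K 0 0) * y = 1 := ⟨_, IsLocalization.Away.mul_invSelf _⟩
    obtain ⟨χ, χ0, χa, χb, χc, χv, χw⟩ := exists_chartInv ι y hy
    -- The localization map factors through `ψ`, so the kernel of `ψ` is killed by powers of `v 0
    -- 0`.
    have hχψ : χ.comp ψ = ι := by
      refine ringHom_ext (fun k => ?_) (fun i r => ?_) (fun i s => ?_)
      · rw [RingHom.comp_apply, ψ0]
        exact χ0 k
      · rw [RingHom.comp_apply]
        refine Fin.cases ?_ (fun j => ?_) i <;> refine Fin.cases ?_ (fun r => ?_) r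
        · rw [ψv, χa]
        · rw [ψr, map_mul, χa, χc]
          linear_combination (ι (v K 0 r.succ)) * hy
        · rw [ψj, χb]
        · rw [ψjr, map_add, map_mul, χv, χb, χc]
          ring
      · rw [RingHom.comp_apply]
        refine Fin.cases ?_ (fun j => ?_) i
        · have h1 := congrArg ι (sum_v_mul_w K (M := M + 1) (p := p + 1) (q := q) 0 s)
          rw [Fin.sum_univ_succ, map_zero, map_add, map_sum, map_mul] at h1
          simp only [map_mul] at h1
          rw [ψw, map_neg, map_sum]
          have χb' : ∀ j, χ (β (X (some (Sum.inl j)))) = ι (v K j.succ 0) := χb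
          simp only [map_mul, χb', χw, ← mul_assoc]
          rw [← Finset.sum_mul, eq_neg_of_add_eq_zero_right h1]
          linear_combination (ι (w K 0 s)) * hy
        · rw [ψwj, map_mul, χa, χw]
          linear_combination (ι (w K j.succ s)) * hy
    have h0 : ι z = 0 := by rw [← hχψ, RingHom.comp_apply, hz, map_zero]
    obtain ⟨⟨_, n, rfl⟩, hn⟩ :=
      (IsLocalization.map_eq_zero_iff (Submonoid.powers (v K 0 0)) _ z).mp h0
    exact ⟨n, hn⟩
  · have hadd : ∀ e f, (∃ (n : ℕ) (z : _), ψ (v K 0 0) ^ n * e = ψ z) →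
        (∃ (n : ℕ) (z : _), ψ (v K 0 0) ^ n * f = ψ z) →
        ∃ (n : ℕ) (z : _), ψ (v K 0 0) ^ n * (e + f) = ψ z := by
      rintro e f ⟨n, z, hz⟩ ⟨m, t, ht⟩
      refine ⟨n + m, v K 0 0 ^ m * z + v K 0 0 ^ n * t, ?_⟩
      rw [map_add, map_mul, map_mul, map_pow, map_pow, ← hz, ← ht]
      ring
    have hmul : ∀ e f, (∃ (n : ℕ) (z : _), ψ (v K 0 0) ^ n * e = ψ z) →
        (∃ (n : ℕ) (z : _), ψ (v K 0 0) ^ n * f = ψ z) →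
        ∃ (n : ℕ) (z : _), ψ (v K 0 0) ^ n * (e * f) = ψ z := by
      rintro e f ⟨n, z, hz⟩ ⟨m, t, ht⟩
      refine ⟨n + m, z * t, ?_⟩
      rw [map_mul, ← hz, ← ht]
      ring
    refine induction_on e (fun k => ?_) (fun j r => ?_) (fun j s => ?_) hadd hmul
    · induction k using MvPolynomial.induction_on with
      | C k => exact ⟨0, ofBase _ _ _ _ k, by rw [pow_zero, one_mul, ψ0]; rfl⟩
      | add f g hf hg => rw [map_add]; exact hadd _ _ hf hg
      | mul_X f o hf =>
        rw [map_mul]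
        refine hmul _ _ hf ?_
        rcases o with _ | (j | r)
        · exact ⟨0, v K 0 0, by rw [pow_zero, one_mul, ψv]⟩
        · exact ⟨0, v K j.succ 0, by rw [pow_zero, one_mul, ψj]⟩
        · exact ⟨1, v K 0 r.succ, by rw [pow_one, ψr, ψv]⟩
    · refine ⟨1, v K 0 0 * v K j.succ r.succ - v K 0 r.succ * v K j.succ 0, ?_⟩
      rw [map_sub, map_mul, map_mul, ψv, ψjr, ψr, ψj]
      ring
    · exact ⟨1, w K j.succ s, by rw [pow_one, ψv, ψwj]⟩

theorem hasNormalChart_w {K : Type} [CommRing K]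
    [IsDomain (BilinearQuotient (ChartBase K M q) M q p)]
    [IsIntegrallyClosed (BilinearQuotient (ChartBase K M q) M q p)] :
    HasNormalChart (BilinearQuotient K (M + 1) p (q + 1)) (w K 0 0) := by
  obtain ⟨e, he⟩ := exists_swap K (M + 1) p (q + 1)
  refine HasNormalChart.of_ringEquiv e ?_
  rw [he]
  exact hasNormalChart_v

end BilinearQuotient

end

/-! ### Regularity of the bilinear forms, and the induction on `p + q`. -/

noncomputable section

open MvPolynomial RingTheory.Sequence

namespace BilinearQuotient

theorem isWeaklyRegular_bilinearForm (K : Type*) [CommRing K] {M p q : ℕ}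
    (idx : Fin p × Fin q → Fin M) (hidx : Function.Injective idx)
    (T : List ((Fin M × Fin p) ⊕ (Fin M × Fin q))) (hT : T.Nodup)
    (hmem : ∀ t, t ∈ T ↔ ∀ e, t ≠ Sum.inl (idx e, e.1) ∧ t ≠ Sum.inr (idx e, e.2)) :
    IsWeaklyRegular (MvPolynomial ((Fin M × Fin p) ⊕ (Fin M × Fin q)) K)
      ((Finset.univ : Finset (Fin p × Fin q)).toList.map (bilinearForm K M p q) ++ T.map X) := by
  classical
  refine isWeaklyRegular_append_X _ _
    (fun e => Finsupp.single (Sum.inl (idx e, e.1)) 1 + Finsupp.single (Sum.inr (idx e, e.2)) 1)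
    T hT ?_ ?_ ?_ ?_ ?_
  · rw [List.pairwise_map]
    refine (Finset.nodup_toList _).imp fun {e e'} hee => ?_
    rw [Finsupp.disjoint_nat_iff]
    have hne : idx e ≠ idx e' := fun h => hee (hidx h)
    rintro (⟨i, r⟩ | ⟨i, s⟩)
    · by_cases h : i = idx e
      · subst h
        exact Or.inr (by simp [hne.symm])
      · exact Or.inl (by simp [Ne.symm h])
    · by_cases h : i = idx e
      · subst h
        exact Or.inr (by simp [hne.symm])
      · exact Or.inl (by simp [Ne.symm h])
  · intro e _ t ht
    have := (hmem t).mp ht e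
    simp [this.1.symm, this.2.symm]
  · intro e _
    have h1 : (monomial (Finsupp.single (Sum.inl (idx e, e.1)) 1 +
        Finsupp.single (Sum.inr (idx e, e.2)) 1) 1 :
        MvPolynomial ((Fin M × Fin p) ⊕ (Fin M × Fin q)) K) =
        X (Sum.inl (idx e, e.1)) * X (Sum.inr (idx e, e.2)) := by
      rw [X, X, monomial_mul, one_mul]
    rw [h1, bilinearForm, ← Finset.add_sum_erase _ _ (Finset.mem_univ (idx e)), add_sub_cancel_left]
    refine sum_mem fun i hi => ?_
    have hi := Finset.ne_of_mem_erase hi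
    -- If neither factor lies in `T`, both are retained at index `i`; injectivity of `idx` makes `e`
    -- the pair retained there, contradicting `i ≠ idx e`.
    by_cases hv : Sum.inl (i, e.1) ∈ T
    · exact Ideal.mul_mem_right _ _ (Ideal.subset_span ⟨_, hv, rfl⟩)
    · refine Ideal.mul_mem_left _ _ (Ideal.subset_span ⟨_, ?_, rfl⟩)
      rw [Set.mem_ofPred_eq, hmem]
      rw [hmem] at hv
      push Not at hv
      obtain ⟨e1, he1⟩ := hv
      have he1' : (i, e.1) = (idx e1, e1.1) := by
        by_contra h
        simpa using he1 (fun h' => h (Sum.inl_injective h'))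
      refine fun e2 => ⟨by simp, fun h => hi ?_⟩
      have h2 : (i, e.2) = (idx e2, e2.2) := Sum.inr_injective h
      simp only [Prod.mk.injEq] at he1' h2
      have h12 : e1 = e2 := hidx (he1'.1.symm.trans h2.1)
      subst h12
      rw [he1'.1, Prod.ext he1'.2 h2.2]
  · intro e _
    exact ⟨2, IsHomogeneous.sum _ _ _ fun i _ => (isHomogeneous_X _ _).mul (isHomogeneous_X _ _)⟩
  · intro e _
    exact sum_mem fun i _ => Ideal.mul_mem_right _ _ (Ideal.subset_span ⟨_, rfl⟩)

theorem bilinearIdeal_eq_ofList (K : Type*) [CommRing K] (M p q : ℕ) :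
    bilinearIdeal K M p q =
      Ideal.ofList ((Finset.univ : Finset (Fin p × Fin q)).toList.map (bilinearForm K M p q)) := by
  rw [bilinearIdeal, Ideal.ofList]
  congr 1
  ext
  simp

/-- An unused pair of variables gives a regular sequence on the quotient. -/
theorem regular_of_injective (K : Type*) [CommRing K] {M p q : ℕ}
    (idx : Fin p × Fin q → Fin M) (hidx : Function.Injective idx)
    {x y : (Fin M × Fin p) ⊕ (Fin M × Fin q)} (hxy : x ≠ y)
    (hx : ∀ e, x ≠ Sum.inl (idx e, e.1) ∧ x ≠ Sum.inr (idx e, e.2))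
    (hy : ∀ e, y ≠ Sum.inl (idx e, e.1) ∧ y ≠ Sum.inr (idx e, e.2)) :
    (∀ z, mk K M p q (X x) * z = 0 → z = 0) ∧
      ∀ c d, mk K M p q (X y) * c = mk K M p q (X x) * d → mk K M p q (X x) ∣ c := by
  classical
  let S : Finset ((Fin M × Fin p) ⊕ (Fin M × Fin q)) := Finset.univ.filter fun t =>
    (∀ e, t ≠ Sum.inl (idx e, e.1) ∧ t ≠ Sum.inr (idx e, e.2)) ∧ t ≠ x ∧ t ≠ y
  refine mul_eq_zero_and_dvd_of_isWeaklyRegular (bilinearIdeal_eq_ofList K M p q)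
    (ts := S.toList.map X)
    (isWeaklyRegular_bilinearForm K idx hidx (x :: y :: S.toList) ?_ fun t => ?_)
  · simp [S, hxy, Finset.nodup_toList]
  · simp only [List.mem_cons, Finset.mem_toList, S, Finset.mem_filter, Finset.mem_univ, true_and]
    constructor
    · rintro (rfl | rfl | h)
      exacts [hx, hy, h.1]
    · intro h
      by_cases h1 : t = x
      · exact Or.inl h1
      · by_cases h2 : t = y
        · exact Or.inr (Or.inl h2)
        · exact Or.inr (Or.inr ⟨h, h1, h2⟩)

theorem exists_injective_index {M p q : ℕ} (hp : p ≤ 1) (hq : q ≤ 1) (hM : p + q + 1 ≤ M) :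
    ∃ idx : Fin (p + 1) × Fin (q + 1) → Fin (M + 1), Function.Injective idx ∧
      ∀ e, idx e = 0 → e.1 ≠ 0 ∧ e.2 ≠ 0 := by
  -- Index `0` may serve only the pair `(1, 1)`, so that `v 0 0` and `w 0 0` stay unused; the other
  -- pairs are numbered from `1`. For `p = q = 1` exactly four indices are needed.
  refine ⟨fun e => if h : e.1.val = 1 ∧ e.2.val = 1 then 0 else
    ⟨1 + e.1 + (p + 1) * e.2, ?_⟩, ?_, ?_⟩
  · obtain ⟨⟨r, hr⟩, ⟨s, hs⟩⟩ := e
    interval_cases p <;> interval_cases q <;> simp at * <;> omega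
  · rintro ⟨⟨r, hr⟩, ⟨s, hs⟩⟩ ⟨⟨r', hr'⟩, ⟨s', hs'⟩⟩ h
    interval_cases p <;> interval_cases q <;> interval_cases r <;> interval_cases s <;>
      interval_cases r' <;> interval_cases s' <;> simp_all [Fin.ext_iff]
  · rintro ⟨⟨r, hr⟩, ⟨s, hs⟩⟩ h
    by_cases h1 : r = 1 ∧ s = 1
    · simp [Fin.ext_iff, h1]
    · simp [h1, Fin.ext_iff] at h

theorem isDomain_and_isIntegrallyClosed_of_isEmpty (K : Type*) [CommRing K] [IsDomain K]
    [UniqueFactorizationMonoid K] (M p q : ℕ) [IsEmpty (Fin p × Fin q)] :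
    IsDomain (BilinearQuotient K M p q) ∧ IsIntegrallyClosed (BilinearQuotient K M p q) := by
  have h : bilinearIdeal K M p q = ⊥ := by
    rw [bilinearIdeal, Set.range_eq_empty, Ideal.span_empty]
  let e : BilinearQuotient K M p q ≃+* MvPolynomial ((Fin M × Fin p) ⊕ (Fin M × Fin q)) K :=
    (Ideal.quotEquivOfEq h).trans (RingEquiv.quotientBot _)
  exact ⟨e.injective.isDomain e.toRingHom, IsIntegrallyClosed.of_equiv e.symm⟩

theorem isDomain_and_isIntegrallyClosed (n : ℕ) : ∀ (K : Type) [CommRing K] [IsDomain K]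
    [UniqueFactorizationMonoid K] (M p q : ℕ), p + q = n → p ≤ 2 → q ≤ 2 → p + q ≤ M →
    IsDomain (BilinearQuotient K M p q) ∧ IsIntegrallyClosed (BilinearQuotient K M p q) := by
  induction n with
  | zero =>
    intro K _ _ _ M p q h _ _ _
    obtain ⟨rfl, rfl⟩ : p = 0 ∧ q = 0 := by omega
    exact isDomain_and_isIntegrallyClosed_of_isEmpty K M 0 0
  | succ n ih =>
    intro K _ _ _ M p q h hp hq hM
    rcases p with _ | p
    · exact isDomain_and_isIntegrallyClosed_of_isEmpty K M 0 q
    rcases q with _ | q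
    · exact isDomain_and_isIntegrallyClosed_of_isEmpty K M (p + 1) 0
    obtain ⟨M, rfl⟩ : ∃ m, M = m + 1 := ⟨M - 1, by omega⟩
    obtain ⟨idx, hidx, h0⟩ := exists_injective_index (M := M) (p := p) (q := q)
      (by omega) (by omega) (by omega)
    have hv : ∀ e : Fin (p + 1) × Fin (q + 1),
        (Sum.inl ((0 : Fin (M + 1)), (0 : Fin (p + 1))) :
          (Fin (M + 1) × Fin (p + 1)) ⊕ (Fin (M + 1) × Fin (q + 1))) ≠ Sum.inl (idx e, e.1) ∧
        (Sum.inl ((0 : Fin (M + 1)), (0 : Fin (p + 1))) :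
          (Fin (M + 1) × Fin (p + 1)) ⊕ (Fin (M + 1) × Fin (q + 1))) ≠ Sum.inr (idx e, e.2) := by
      refine fun e => ⟨fun he => ?_, by simp⟩
      have h1 := Prod.mk.inj (Sum.inl_injective he)
      exact (h0 e h1.1.symm).1 h1.2.symm
    have hw : ∀ e : Fin (p + 1) × Fin (q + 1),
        (Sum.inr ((0 : Fin (M + 1)), (0 : Fin (q + 1))) :
          (Fin (M + 1) × Fin (p + 1)) ⊕ (Fin (M + 1) × Fin (q + 1))) ≠ Sum.inl (idx e, e.1) ∧
        (Sum.inr ((0 : Fin (M + 1)), (0 : Fin (q + 1))) :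
          (Fin (M + 1) × Fin (p + 1)) ⊕ (Fin (M + 1) × Fin (q + 1))) ≠ Sum.inr (idx e, e.2) := by
      refine fun e => ⟨by simp, fun he => ?_⟩
      have h1 := Prod.mk.inj (Sum.inr_injective he)
      exact (h0 e h1.1.symm).2 h1.2.symm
    have hreg := regular_of_injective K idx hidx (by simp) hv hw
    have hreg' := regular_of_injective K idx hidx (by simp) hw hv
    obtain ⟨_, _⟩ := ih (ChartBase K M p) M p (q + 1) (by omega) (by omega) hq (by omega)
    obtain ⟨_, _⟩ := ih (ChartBase K M q) M q (p + 1) (by omega) (by omega) hp (by omega)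
    exact isDomain_and_isIntegrallyClosed_of_normalCharts (x := v K 0 0) (y := w K 0 0)
      hreg.1 hreg'.1 hreg.2 hasNormalChart_v hasNormalChart_w

end BilinearQuotient

end

/-! ### The spinor quotient, and descent to momenta by torus invariants. -/

theorem spinorIdeal_eq_bilinearIdeal (N : ℕ) : spinorIdeal N = bilinearIdeal ℂ N 2 2 := by
  rw [spinorIdeal, bilinearIdeal]
  congr 2
  ext1 e
  simp [bilinearForm, Matrix.sum_apply, Matrix.vecMulVec_apply, spinorV, spinorW]

theorem isDomain_and_isIntegrallyClosed_spinorRing_quotient {N : ℕ} (hN : 4 ≤ N) :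
    IsDomain (SpinorRing N ⧸ spinorIdeal N) ∧
      IsIntegrallyClosed (SpinorRing N ⧸ spinorIdeal N) := by
  rw [spinorIdeal_eq_bilinearIdeal]
  exact BilinearQuotient.isDomain_and_isIntegrallyClosed 4 ℂ N 2 2 rfl le_rfl le_rfl hN

/-- The monomial in the entries of the `2 × 2` matrix `m` with row degrees `α` and column degrees
`β`, taken to involve only one of the two off-diagonal entries. -/
def toricMonomial {R : Type*} [CommRing R] (m : Fin 2 → Fin 2 → R) (α β : Fin 2 → ℕ) : R :=
  m 0 0 ^ min (α 0) (β 0) * m 0 1 ^ (α 0 - β 0) * m 1 0 ^ (β 0 - α 0) *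
    m 1 1 ^ (α 1 - (β 0 - α 0))

/-- When a new off-diagonal factor meets the opposite one, `hm` trades the two for the diagonal
pair, restoring the normal form. The balance `h` keeps the truncated exponent of `m 1 1` exact. -/
theorem toricMonomial_add_single {R : Type*} [CommRing R] {m : Fin 2 → Fin 2 → R}
    (hm : m 0 0 * m 1 1 = m 0 1 * m 1 0) {α β α' β' : Fin 2 → ℕ}
    (h : α 0 + α 1 = β 0 + β 1) (r s : Fin 2)
    (hα : ∀ t, α' t = α t + if t = r then 1 else 0)
    (hβ : ∀ t, β' t = β t + if t = s then 1 else 0) :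
    toricMonomial m α' β' = m r s * toricMonomial m α β := by
  have h0 := hα 0
  have h1 := hα 1
  have h2 := hβ 0
  simp only [toricMonomial, h0, h1, h2]
  clear h0 h1 h2 hα hβ
  generalize α 0 = a at *
  generalize α 1 = b at *
  generalize β 0 = c at *
  generalize β 1 = d at *
  fin_cases r <;> fin_cases s
  · simp [Nat.add_min_add_right]
    ring
  · simp
    rcases lt_or_ge a c with hac | hac
    · obtain ⟨k, rfl⟩ : ∃ k, c = a + k + 1 := ⟨c - a - 1, by omega⟩
      obtain ⟨l, rfl⟩ : ∃ l, b = k + 1 + l := ⟨b - (k + 1), by omega⟩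
      rw [min_eq_left (by omega), min_eq_left (by omega), show a + 1 - (a + k + 1) = 0 by omega,
        show a + k + 1 - (a + 1) = k by omega, show a - (a + k + 1) = 0 by omega,
        show a + k + 1 - a = k + 1 by omega, show k + 1 + l - k = l + 1 by omega,
        show k + 1 + l - (k + 1) = l by omega]
      linear_combination (m 0 0 ^ a * m 1 0 ^ k * m 1 1 ^ l) * hm
    · obtain ⟨k, rfl⟩ : ∃ k, a = c + k := ⟨a - c, by omega⟩
      rw [min_eq_right (by omega), min_eq_right (by omega), show c + k + 1 - c = k + 1 by omega,
        show c - (c + k + 1) = 0 by omega, show c + k - c = k by omega,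
        show c - (c + k) = 0 by omega]
      ring
  · simp
    rcases lt_or_ge c a with hac | hac
    · obtain ⟨k, rfl⟩ : ∃ k, a = c + k + 1 := ⟨a - c - 1, by omega⟩
      rw [min_eq_right (by omega), min_eq_right (by omega),
        show c + k + 1 - (c + 1) = k by omega, show c + 1 - (c + k + 1) = 0 by omega,
        show c + k + 1 - c = k + 1 by omega, show c - (c + k + 1) = 0 by omega]
      simp only [tsub_zero]
      linear_combination (m 0 0 ^ c * m 0 1 ^ k * m 1 1 ^ b) * hm
    · obtain ⟨k, rfl⟩ : ∃ k, c = a + k := ⟨c - a, by omega⟩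
      rw [min_eq_left (by omega), min_eq_left (by omega), show a - (a + k + 1) = 0 by omega,
        show a + k + 1 - a = k + 1 by omega, show a - (a + k) = 0 by omega,
        show a + k - a = k by omega, show b + 1 - (k + 1) = b - k by omega]
      ring
  · simp
    rw [show b + 1 - (c - a) = b - (c - a) + 1 by omega]
    ring

noncomputable section

open MvPolynomial

/-- The class of the entry `(r, s)` of the `i`-th momentum. -/
def momentumClass {N : ℕ} (i : Fin N) (r s : Fin 2) : MomentumRing N ⧸ momentumIdeal N :=
  Ideal.Quotient.mk _ (X (i, r, s))

theorem momentumClass_det {N : ℕ} (i : Fin N) :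
    momentumClass i 0 0 * momentumClass i 1 1 = momentumClass i 0 1 * momentumClass i 1 0 := by
  rw [← sub_eq_zero]
  exact Ideal.Quotient.eq_zero_iff_mem.mpr (Ideal.subset_span (Or.inr ⟨i, rfl⟩))

/-- Torus-invariant exponents: the degrees in `v i` and `w i` agree for each `i`. -/
def IsBalanced {N : ℕ} (e : (Fin N × Fin 2) ⊕ (Fin N × Fin 2) →₀ ℕ) : Prop :=
  ∀ i, e (Sum.inl (i, 0)) + e (Sum.inl (i, 1)) = e (Sum.inr (i, 0)) + e (Sum.inr (i, 1))

open Classical in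
/-- The image of a spinor monomial under the projection to torus invariants, written in momenta. -/
def momentumOfExponent {N : ℕ} (e : (Fin N × Fin 2) ⊕ (Fin N × Fin 2) →₀ ℕ) :
    MomentumRing N ⧸ momentumIdeal N :=
  if IsBalanced e then ∏ i, toricMonomial (momentumClass i) (fun r => e (Sum.inl (i, r)))
    (fun s => e (Sum.inr (i, s))) else 0

theorem momentumOfExponent_add {N : ℕ} (e : (Fin N × Fin 2) ⊕ (Fin N × Fin 2) →₀ ℕ)
    (i : Fin N) (r s : Fin 2) :
    momentumOfExponent (Finsupp.single (Sum.inl (i, r)) 1 + Finsupp.single (Sum.inr (i, s)) 1 + e) =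
      momentumClass i r s * momentumOfExponent e := by
  classical
  set e' := Finsupp.single (Sum.inl (i, r)) 1 + Finsupp.single (Sum.inr (i, s)) 1 + e with he'
  have hl : ∀ j t, e' (Sum.inl (j, t)) = e (Sum.inl (j, t)) + if j = i ∧ t = r then 1 else 0 := by
    intro j t
    simp only [he', Finsupp.add_apply, Finsupp.single_apply, Sum.inl.injEq, Prod.mk.injEq,
      reduceCtorEq, if_false, add_zero, add_comm (e _), @eq_comm _ i, @eq_comm _ r]
  have hr : ∀ j t, e' (Sum.inr (j, t)) = e (Sum.inr (j, t)) + if j = i ∧ t = s then 1 else 0 := by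
    intro j t
    simp only [he', Finsupp.add_apply, Finsupp.single_apply, Sum.inr.injEq, Prod.mk.injEq,
      reduceCtorEq, if_false, zero_add, add_comm (e _), @eq_comm _ i, @eq_comm _ s]
  have hbal : IsBalanced e' ↔ IsBalanced e := by
    refine forall_congr' fun j => ?_
    rw [hl, hl, hr, hr]
    by_cases hj : j = i
    · fin_cases r <;> fin_cases s <;> simp [hj] <;> omega
    · simp [hj]
  unfold momentumOfExponent
  rw [hbal]
  split_ifs with h
  · have h1 : toricMonomial (momentumClass i) (fun t => e' (Sum.inl (i, t)))
        (fun t => e' (Sum.inr (i, t))) = momentumClass i r s * toricMonomial (momentumClass i)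
        (fun t => e (Sum.inl (i, t))) (fun t => e (Sum.inr (i, t))) :=
      toricMonomial_add_single (momentumClass_det i) (h i) r s
        (fun t => by simp [hl]) (fun t => by simp [hr])
    have h2 : ∀ j ∈ Finset.univ.erase i, toricMonomial (momentumClass j)
        (fun t => e' (Sum.inl (j, t))) (fun t => e' (Sum.inr (j, t))) =
        toricMonomial (momentumClass j) (fun t => e (Sum.inl (j, t)))
        (fun t => e (Sum.inr (j, t))) := by
      intro j hj
      have hj := Finset.ne_of_mem_erase hj
      simp only [hl, hr, hj, false_and, if_false, add_zero]
    rw [← Finset.mul_prod_erase _ _ (Finset.mem_univ i), Finset.prod_congr rfl h2, h1, mul_assoc,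
      Finset.mul_prod_erase Finset.univ (fun j => toricMonomial (momentumClass j)
        (fun t => e (Sum.inl (j, t))) (fun t => e (Sum.inr (j, t)))) (Finset.mem_univ i)]
  · rw [mul_zero]

/-- The projection of spinor polynomials to torus invariants, written in momenta. -/
def invariantPart (N : ℕ) : SpinorRing N →ₗ[ℂ] MomentumRing N ⧸ momentumIdeal N :=
  (basisMonomials _ ℂ).constr ℂ momentumOfExponent

theorem invariantPart_monomial {N : ℕ} (e : (Fin N × Fin 2) ⊕ (Fin N × Fin 2) →₀ ℕ) (c : ℂ) :
    invariantPart N (monomial e c) = c • momentumOfExponent e := by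
  have h : monomial e c = c • basisMonomials _ ℂ e := by simp [smul_monomial]
  rw [h, map_smul, invariantPart, Module.Basis.constr_basis]

/-- The substitution of `v i * (w i)ᵀ` for the `i`-th momentum. -/
def spinorSubst (N : ℕ) : MomentumRing N →ₐ[ℂ] SpinorRing N :=
  aeval fun k => X (Sum.inl (k.1, k.2.1)) * X (Sum.inr (k.1, k.2.2))

/-- Linearity over momenta reduces to one variable times one monomial: `v_i w_i` preserves balance,
and the normal forms multiply correctly because `Q_i = 0` in the quotient. -/
theorem invariantPart_spinorSubst_mul {N : ℕ} (g : MomentumRing N) (f : SpinorRing N) :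
    invariantPart N (spinorSubst N g * f) = Ideal.Quotient.mk _ g * invariantPart N f := by
  induction g using MvPolynomial.induction_on generalizing f with
  | C c =>
    have h : Ideal.Quotient.mk (momentumIdeal N) (C c) = algebraMap ℂ _ c := rfl
    rw [h, ← Algebra.smul_def, ← map_smul, spinorSubst, ← algebraMap_eq, AlgHom.commutes,
      ← Algebra.smul_def]
  | add g h hg hh => rw [map_add, add_mul, map_add, map_add, hg, hh, add_mul]
  | mul_X g k hg =>
    have hX : ∀ f, invariantPart N (spinorSubst N (X k) * f) =
        momentumClass k.1 k.2.1 k.2.2 * invariantPart N f := by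
      intro f
      induction f using MvPolynomial.induction_on' with
      | monomial e c =>
        rw [spinorSubst, aeval_X, X, X, monomial_mul, monomial_mul, invariantPart_monomial,
          invariantPart_monomial, momentumOfExponent_add, mul_smul_comm, one_mul, one_mul]
      | add f g hf hg => rw [mul_add, map_add, map_add, hf, hg, mul_add]
    rw [map_mul (spinorSubst N), map_mul (Ideal.Quotient.mk _), mul_assoc, hg, hX, mul_assoc]
    rfl

theorem spinorSubst_sum_momentum {N : ℕ} (r s : Fin 2) :
    spinorSubst N ((∑ i : Fin N, momentum i) r s) =
      (∑ i : Fin N, Matrix.vecMulVec (spinorV i) (spinorW i)) r s := by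
  simp [Matrix.sum_apply, Matrix.vecMulVec_apply, momentum, spinorSubst, spinorV, spinorW]

theorem invariantPart_eq_zero {N : ℕ} {f : SpinorRing N} (hf : f ∈ spinorIdeal N) :
    invariantPart N f = 0 := by
  -- `invariantPart` is linear over momenta only, so arbitrary spinor multiples must be carried
  -- through the induction.
  suffices h : ∀ g, invariantPart N (f * g) = 0 by simpa using h 1
  rw [spinorIdeal] at hf
  induction hf using Submodule.span_induction with
  | mem f hf =>
    obtain ⟨⟨r, s⟩, rfl⟩ := hf
    intro g
    have h : (∑ i : Fin N, momentum i) r s ∈ momentumIdeal N :=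
      Ideal.subset_span (Or.inl ⟨(r, s), rfl⟩)
    dsimp only
    rw [← spinorSubst_sum_momentum, invariantPart_spinorSubst_mul,
      Ideal.Quotient.eq_zero_iff_mem.mpr h, zero_mul]
  | zero => simp
  | add x y _ _ hx hy => exact fun g => by rw [add_mul, map_add, hx, hy, add_zero]
  | smul a x _ hx => exact fun g => by rw [smul_eq_mul, mul_comm a, mul_assoc, hx]

theorem invariantPart_one (N : ℕ) : invariantPart N 1 = 1 := by
  have h : (1 : SpinorRing N) = monomial 0 1 := rfl
  rw [h, invariantPart_monomial, one_smul, momentumOfExponent, if_pos (show IsBalanced 0 from fun i => by simp)]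
  simp [toricMonomial]

theorem spinorSubst_mem {N : ℕ} {g : MomentumRing N} (hg : g ∈ momentumIdeal N) :
    spinorSubst N g ∈ spinorIdeal N := by
  have h : momentumIdeal N ≤ (spinorIdeal N).comap (spinorSubst N) := by
    rw [momentumIdeal, Ideal.span_le]
    rintro _ (⟨⟨r, s⟩, rfl⟩ | ⟨i, rfl⟩)
    · rw [SetLike.mem_coe, Ideal.mem_comap, spinorSubst_sum_momentum]
      exact Ideal.subset_span ⟨(r, s), rfl⟩
    · have h0 : spinorSubst N (coneQuadric i) = 0 := by
        simp [spinorSubst, coneQuadric, momentum]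
        ring
      simp [h0]
  exact h hg

theorem isDomain_and_isIntegrallyClosed_momentumRing_quotient {N : ℕ} (hN : 4 ≤ N) :
    IsDomain (MomentumRing N ⧸ momentumIdeal N) ∧
      IsIntegrallyClosed (MomentumRing N ⧸ momentumIdeal N) := by
  obtain ⟨_, _⟩ := isDomain_and_isIntegrallyClosed_spinorRing_quotient hN
  let φ : MomentumRing N ⧸ momentumIdeal N →+* SpinorRing N ⧸ spinorIdeal N :=
    Ideal.quotientMap _ (spinorSubst N : MomentumRing N →+* SpinorRing N)
      fun _ hg => spinorSubst_mem hg
  have hsurj := Ideal.Quotient.mk_surjective (I := spinorIdeal N)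
  let ρ : SpinorRing N ⧸ spinorIdeal N → MomentumRing N ⧸ momentumIdeal N :=
    fun z => invariantPart N (Function.surjInv hsurj z)
  -- The chosen lift is immaterial, since `invariantPart` kills `spinorIdeal N`.
  have hρ : ∀ f, ρ (Ideal.Quotient.mk _ f) = invariantPart N f := by
    intro f
    rw [← sub_eq_zero, ← map_sub]
    exact invariantPart_eq_zero (Ideal.Quotient.eq.mp (Function.surjInv_eq hsurj _))
  refine isDomain_and_isIntegrallyClosed_of_retraction φ ρ (fun b c => ?_) ?_
  · obtain ⟨g, rfl⟩ := Ideal.Quotient.mk_surjective b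
    obtain ⟨f, rfl⟩ := Ideal.Quotient.mk_surjective c
    have h : φ (Ideal.Quotient.mk _ g) = Ideal.Quotient.mk _ (spinorSubst N g) :=
      Ideal.quotientMap_mk
    rw [h, ← map_mul, hρ, hρ, invariantPart_spinorSubst_mul]
  · rw [← map_one (Ideal.Quotient.mk _), hρ, invariantPart_one]

end

theorem mainTheorem11 (N : ℕ) (hN : 4 ≤ N) :
    (momentumIdeal N).IsPrime ∧ (spinorIdeal N).IsPrime ∧
    (IsNoetherianRing (MomentumRing N ⧸ momentumIdeal N) ∧
      IsDomain (MomentumRing N ⧸ momentumIdeal N) ∧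
      IsIntegrallyClosed (MomentumRing N ⧸ momentumIdeal N)) ∧
    (IsNoetherianRing (SpinorRing N ⧸ spinorIdeal N) ∧
      IsDomain (SpinorRing N ⧸ spinorIdeal N) ∧
      IsIntegrallyClosed (SpinorRing N ⧸ spinorIdeal N)) := by
  have hk := isDomain_and_isIntegrallyClosed_momentumRing_quotient hN
  have hs := isDomain_and_isIntegrallyClosed_spinorRing_quotient hN
  exact ⟨(Ideal.Quotient.isDomain_iff_prime _).mp hk.1,
    (Ideal.Quotient.isDomain_iff_prime _).mp hs.1, ⟨inferInstance, hk⟩, ⟨inferInstance, hs⟩⟩
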